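/- Fix $j>0$, an integer $K\ge 1$, a time horizon $T>0$ and a smooth function $u_0:[-1,1]\to[0,1]$. For an integer $N\ge K$ put $\epsilon=1/N$, $\Lambda_N=\{-N,\dots,N\}$, $I_+=\{N-K+1,\dots,N\}$, $I_-=\{-N,\dots,-N+K-1\}$, and for $u:\Lambda_N\to\mathbb R$ let $$D_+u(x)=[1-u(x)]\,u(x+1)\cdots u(N)\quad(x\in I_+),\qquad D_-u(x)=u(x)\,[1-u(x-1)]\cdots[1-u(-N)]\quad(x\in I_-).$$ Let $\Delta$ be the discrete Laplacian on $\Lambda_N$ with reflecting boundary conditions: $\Delta u(x)=u(x+1)+u(x-1)-2u(x)$ for $|x|<N$ and $\Delta u(\pm N)=u(\pm(N-1))-u(\pm N)$. Let $\rho_\epsilon(x,t)$, $x\in\Lambda_N$, $0\le t\le T$, be the solution of $$\partial_t\rho_\epsilon(x,t)=\tfrac12\epsilon^{-2}\Delta\rho_\epsilon(x,t)+\epsilon^{-1}\tfrac j2\Big(\mathbf 1_{x\in I_+}D_+\rho_\epsilon(x,t)-\mathbf 1_{x\in I_-}D_-\rho_\epsilon(x,t)\Big),\qquad \rho_\epsilon(x,0)=u_0(\epsilon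 x),$$ and let $G_t(x,y)=\dfrac{e^{-(x-y)^2/2t}}{\sqrt{2\pi t}}$ for $t>0$. (i) There is a constant $c_T$, independent of $N$, $x$ and $t$, such that whenever $\epsilon<1$, $x\in\{-N,\dots,N-1\}$ and $0\le t\le T$, the integral below converges and $$|\rho_\epsilon(x,t)-\rho_\epsilon(x+1,t)|\le c_T\,\epsilon+\epsilon^{-1}\frac j2\int_0^t\frac{1}{\sqrt{\epsilon^{-2}\lambda}+1}\sum_{z\in I_-\cup I_+}G_{\epsilon^{-2}\lambda}(x,z)\,d\lambda .$$ (ii) Consequently, for every $\zeta>0$ there is a constant $C_T$, independent of $N$ and $t$, such that whenever $\epsilon<1$ and $0\le t\le T$, $$\sup_{x,y\in\Lambda_N:\,|x-y|\le1}|\rho_\epsilon(x,t)-\rho_\epsilon(y,t)|\le C_T\,\epsilon^{1-2\zeta}.$$ -/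

import Mathlib

open scoped ContDiff

noncomputable section

namespace StirringBD

/-- The scaling parameter `ε = 1 / N`. -/
def eps (N : ℕ) : ℝ := 1 / (N : ℝ)

/-- The discrete interval `Λ_N = {-N, …, N}`. -/
def sites (N : ℕ) : Finset ℤ := Finset.Icc (-(N : ℤ)) (N : ℤ)

/-- The right boundary region `I_+ = {N - K + 1, …, N}`. -/
def rightBdry (N K : ℕ) : Finset ℤ := Finset.Icc ((N : ℤ) - (K : ℤ) + 1) (N : ℤ)

/-- The left boundary region `I_- = {-N, …, -N + K - 1}`. -/
def leftBdry (N K : ℕ) : Finset ℤ := Finset.Icc (-(N : ℤ)) (-(N : ℤ) + (K : ℤ) - 1)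

/-- `D_+ u (x) = (1 - u(x)) u(x+1) ⋯ u(N)`. -/
def Dplus (N : ℕ) (u : ℤ → ℝ) (x : ℤ) : ℝ :=
  (1 - u x) * ∏ y ∈ Finset.Ioc x (N : ℤ), u y

/-- `D_- u (x) = u(x) (1 - u(x-1)) ⋯ (1 - u(-N))`. -/
def Dminus (N : ℕ) (u : ℤ → ℝ) (x : ℤ) : ℝ :=
  u x * ∏ y ∈ Finset.Ico (-(N : ℤ)) x, (1 - u y)

/-- The discrete Laplacian on `Λ_N` with reflecting boundary conditions
(only values of `u` on `Λ_N` enter when `x ∈ Λ_N` and `N ≥ 1`). -/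
def reflLaplacian (N : ℕ) (u : ℤ → ℝ) (x : ℤ) : ℝ :=
  if x = (N : ℤ) then u ((N : ℤ) - 1) - u (N : ℤ)
  else if x = -(N : ℤ) then u (-(N : ℤ) + 1) - u (-(N : ℤ))
  else u (x + 1) + u (x - 1) - 2 * u x

/-- The right-hand side of the discrete equation, evaluated at the profile `u` and the site `x`. -/
def drift (j : ℝ) (K N : ℕ) (u : ℤ → ℝ) (x : ℤ) : ℝ :=
  (1 / 2) * ((eps N) ^ (-2 : ℤ) * reflLaplacian N u x) +
    (eps N)⁻¹ * (j / 2) *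
      ((if x ∈ rightBdry N K then Dplus N u x else 0) -
        (if x ∈ leftBdry N K then Dminus N u x else 0))

/-- `ρ` (time first, then site) solves the discrete equation on `[0, T] × Λ_N`
with initial datum `x ↦ u₀ (ε x)`; time derivatives are one-sided at the end points. -/
def IsSolution (j : ℝ) (K N : ℕ) (u₀ : ℝ → ℝ) (T : ℝ) (ρ : ℝ → ℤ → ℝ) : Prop :=
  (∀ x ∈ sites N, ρ 0 x = u₀ (eps N * (x : ℝ))) ∧
  ∀ x ∈ sites N, ∀ t ∈ Set.Icc (0 : ℝ) T,
    HasDerivWithinAt (fun s => ρ s x) (drift j K N (ρ t) x) (Set.Icc (0 : ℝ) T) t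

/-- The heat kernel `G_t(x, y) = exp (-(x - y)² / (2 t)) / √(2 π t)`, for `t > 0`. -/
def heatKernel (t x y : ℝ) : ℝ :=
  Real.exp (-(x - y) ^ 2 / (2 * t)) / Real.sqrt (2 * Real.pi * t)

/-- The integrand
`(√(ε⁻² s) + 1)⁻¹ * ∑_{z ∈ I_- ∪ I_+} G_{ε⁻² s}(x, z)`. -/
def bdryIntegrand (K N : ℕ) (x : ℤ) (s : ℝ) : ℝ :=
  1 / (Real.sqrt ((eps N) ^ (-2 : ℤ) * s) + 1) *
    ∑ z ∈ leftBdry N K ∪ rightBdry N K, heatKernel ((eps N) ^ (-2 : ℤ) * s) (x : ℝ) (z : ℝ)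

end StirringBD

end

/-!
The nearest-neighbour differences of the solution are in fact `O(ε)`, uniformly on `[0, T]`; both
parts follow, since the integral in the first is nonnegative and `ε ≤ ε ^ (1 - 2 ζ)` for `ε < 1`.
The uniform bound is obtained by two comparison arguments, both based on
`neg_of_forall_deriv_neg_at_zero` (finitely many functions cannot leave the negative half-line if
each has negative derivative where it first reaches `0`), and uses no heat kernel estimate.

* The solution takes values in `[0, 1]` (`IsSolution.mem_Icc`). When a profile with values in
  `[-η, 1 + η]` touches `-η` or `1 + η`, the Laplacian pushes inwards and the boundary term pushes
  outwards by at most a multiple of `η`, so `η = κ e ^ (L (t - T))` with `L` large cannot be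
  touched. In particular the boundary term is bounded by `1` (`abs_bdryTerm_le_one`).
* The gradient `v(x) = ρ(x + 1) - ρ(x)` solves
  `∂ₜ v = ½ ε⁻² Δ v + ε⁻¹ (j / 2) (B(x + 1) - B(x))` with `v = 0` at the ghost bonds `-N - 1` and
  `N` (`drift_sub_eq`). The source has size `j ε⁻¹`, but it lives within distance `K` of the
  Dirichlet points, where the Green function is bounded by `K`. So there is a stationary
  supersolution of size `O(ε)`: a multiple of `ε` times `barrier`, plus a constant of order `ε`
  that dominates the initial gradient, `u₀` being Lipschitz (`IsSolution.abs_sub_le`).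
-/

namespace StirringBD

/-! ### A first-contact comparison principle -/

/-- First-contact principle: at the first time some `f i` reaches `0`, all `f k` are still
nonpositive and the left difference quotients force `f' i ≥ 0`. Hence if contact with `0` from
below always comes with `f' i < 0`, there is no contact. -/
theorem neg_of_forall_deriv_neg_at_zero {ι : Type*} (s : Finset ι) {T : ℝ} (f f' : ι → ℝ → ℝ)
    (hf : ∀ i ∈ s, ∀ t ∈ Set.Icc (0 : ℝ) T,
      HasDerivWithinAt (f i) (f' i t) (Set.Icc (0 : ℝ) T) t)
    (h0 : ∀ i ∈ s, f i 0 < 0)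
    (hcontact : ∀ t ∈ Set.Icc (0 : ℝ) T, (∀ k ∈ s, f k t ≤ 0) → ∀ i ∈ s, f i t = 0 → f' i t < 0) :
    ∀ t ∈ Set.Icc (0 : ℝ) T, ∀ i ∈ s, f i t < 0 := by
  have hcont : ∀ i ∈ s, ContinuousOn (f i) (Set.Icc (0 : ℝ) T) :=
    fun i hi t ht => (hf i hi t ht).continuousWithinAt
  by_contra! hbad
  obtain ⟨t₁, ht₁, i₁, hi₁, hfi₁⟩ := hbad
  let B : Set ℝ := ⋃ i ∈ s, Set.Icc (0 : ℝ) T ∩ f i ⁻¹' Set.Ici 0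
  have hBc : IsClosed B :=
    s.finite_toSet.isClosed_biUnion fun i hi =>
      (hcont i hi).preimage_isClosed_of_isClosed isClosed_Icc isClosed_Ici
  have hBne : B.Nonempty := ⟨t₁, Set.mem_biUnion hi₁ ⟨ht₁, hfi₁⟩⟩
  have hBsub : B ⊆ Set.Icc (0 : ℝ) T := Set.iUnion₂_subset fun i _ => Set.inter_subset_left
  obtain ⟨t, htB, htmin⟩ := (isCompact_Icc.of_isClosed_subset hBc hBsub).exists_isLeast hBne
  have ht := hBsub htB
  obtain ⟨i, hi, -, hit⟩ := Set.mem_iUnion₂.1 htB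
  have hit : 0 ≤ f i t := hit
  have hlt : ∀ r ∈ Set.Ico 0 t, ∀ k ∈ s, f k r < 0 := by
    intro r hr k hk
    by_contra! h
    exact absurd (htmin (Set.mem_biUnion hk ⟨⟨hr.1, hr.2.le.trans ht.2⟩, h⟩)) (not_le.2 hr.2)
  have htpos : 0 < t := by
    rcases ht.1.eq_or_lt with h | h
    · exact absurd (h ▸ h0 i hi) (not_lt.2 hit)
    · exact h
  have hIoo : Set.Ioo 0 t ⊆ Set.Icc (0 : ℝ) T := fun r hr => ⟨hr.1.le, hr.2.le.trans ht.2⟩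
  have : (nhdsWithin t (Set.Ioo 0 t)).NeBot := by
    rw [nhdsWithin_Ioo_eq_nhdsLT htpos]; infer_instance
  have hle : ∀ k ∈ s, f k t ≤ 0 := fun k hk =>
    le_of_tendsto (((hcont k hk) t ht).mono hIoo)
      (Filter.eventually_of_mem self_mem_nhdsWithin fun r hr => (hlt r ⟨hr.1.le, hr.2⟩ k hk).le)
  have hzero : f i t = 0 := le_antisymm (hle i hi) hit
  have hder := (hasDerivWithinAt_iff_tendsto_slope' (fun h : t ∈ Set.Ioo 0 t => h.2.ne rfl)).1
    ((hf i hi t ht).mono hIoo)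
  have hnonneg : 0 ≤ f' i t := by
    refine ge_of_tendsto hder (Filter.eventually_of_mem self_mem_nhdsWithin fun r hr => ?_)
    rw [slope_def_field, hzero]
    exact div_nonneg_of_nonpos (by linarith [hlt r ⟨hr.1.le, hr.2⟩ i hi]) (by linarith [hr.2])
  exact absurd (hcontact t ht hle i hi hzero) (not_lt.2 hnonneg)

/-! ### Products of factors close to the unit interval -/

/-- A product of factors in `[-η, 1 + η]` is at least of order `-η`, because it is negative only if
one of its factors lies in `[-η, 0)`. -/
theorem prod_mem_of_near_unit {ι : Type*} [DecidableEq ι] (s : Finset ι) (u : ι → ℝ) {η : ℝ}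
    (hη0 : 0 ≤ η) (hη1 : η ≤ 1) (hu : ∀ y ∈ s, -η ≤ u y ∧ u y ≤ 1 + η) :
    -(η * 2 ^ s.card) ≤ ∏ y ∈ s, u y ∧ ∏ y ∈ s, u y ≤ 2 ^ s.card := by
  induction s using Finset.induction_on with
  | empty => simp; linarith
  | insert a s ha ih =>
    obtain ⟨h1, h2⟩ := ih fun y hy => hu y (Finset.mem_insert_of_mem hy)
    obtain ⟨h3, h4⟩ := hu a (Finset.mem_insert_self a s)
    rw [Finset.prod_insert ha, Finset.card_insert_of_notMem ha, pow_succ]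
    have hQ : (0 : ℝ) < 2 ^ s.card := by positivity
    generalize (2 : ℝ) ^ s.card = Q at *
    generalize ∏ y ∈ s, u y = P at *
    generalize u a = b at *
    have hηQ : 0 ≤ η * Q := by positivity
    have hηQ1 : η * Q ≤ Q := by nlinarith
    rcases le_total 0 b with hb | hb
    · constructor
      · nlinarith [mul_le_mul_of_nonneg_left h1 hb]
      · nlinarith [mul_le_mul_of_nonneg_left h2 hb]
    · constructor
      · nlinarith [mul_le_mul_of_nonpos_left h2 hb]
      · nlinarith [mul_le_mul_of_nonpos_left h1 hb]

theorem prod_mem_of_near_unit_of_card_le {ι : Type*} [DecidableEq ι] (s : Finset ι) (u : ι → ℝ)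
    {η : ℝ} {n : ℕ} (hn : s.card ≤ n) (hη0 : 0 ≤ η) (hη1 : η ≤ 1)
    (hu : ∀ y ∈ s, -η ≤ u y ∧ u y ≤ 1 + η) :
    -(η * 2 ^ n) ≤ ∏ y ∈ s, u y ∧ ∏ y ∈ s, u y ≤ 2 ^ n := by
  obtain ⟨h1, h2⟩ := prod_mem_of_near_unit s u hη0 hη1 hu
  have hle : (2 : ℝ) ^ s.card ≤ 2 ^ n := pow_le_pow_right₀ (by norm_num) hn
  exact ⟨by nlinarith, h2.trans hle⟩

/-! ### The equation in terms of the discrete gradient -/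

theorem eps_pos {N : ℕ} (hN : 1 ≤ N) : 0 < eps N :=
  one_div_pos.2 (by exact_mod_cast hN)

/-- The discrete gradient `u (x + 1) - u x` along the bonds of `Λ_N`, set to `0` outside, so that
the reflecting boundary condition for `u` becomes a Dirichlet condition for the gradient. -/
noncomputable def bondGrad (N : ℕ) (u : ℤ → ℝ) (x : ℤ) : ℝ :=
  if -(N : ℤ) ≤ x ∧ x < N then u (x + 1) - u x else 0

/-- The boundary term `1_{I_+} D_+ u - 1_{I_-} D_- u` of the equation. -/
noncomputable def bdryTerm (K N : ℕ) (u : ℤ → ℝ) (x : ℤ) : ℝ :=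
  (if x ∈ rightBdry N K then Dplus N u x else 0) - (if x ∈ leftBdry N K then Dminus N u x else 0)

theorem reflLaplacian_eq_bondGrad_sub {N : ℕ} (hN : 1 ≤ N) (u : ℤ → ℝ) {x : ℤ}
    (hx : x ∈ sites N) : reflLaplacian N u x = bondGrad N u x - bondGrad N u (x - 1) := by
  obtain ⟨h1, h2⟩ := Finset.mem_Icc.1 hx
  unfold reflLaplacian bondGrad
  by_cases hr : x = N
  · subst hr
    rw [if_pos rfl, if_neg (by omega), if_pos (by omega)]
    simp
  by_cases hl : x = -(N : ℤ)
  · subst hl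
    rw [if_neg hr, if_pos rfl, if_pos (by omega), if_neg (by omega)]
    simp
  · rw [if_neg hr, if_neg hl, if_pos (by omega), if_pos (by omega)]
    simp only [sub_add_cancel]
    ring

theorem reflLaplacian_nonneg_of_forall_le {N : ℕ} (hN : 1 ≤ N) (u : ℤ → ℝ) {x : ℤ}
    (hx : x ∈ sites N) (hmin : ∀ y ∈ sites N, u x ≤ u y) : 0 ≤ reflLaplacian N u x := by
  obtain ⟨h1, h2⟩ := Finset.mem_Icc.1 hx
  have hmem : ∀ y : ℤ, -(N : ℤ) ≤ y → y ≤ N → u x ≤ u y :=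
    fun y hy hy' => hmin y (Finset.mem_Icc.2 ⟨hy, hy'⟩)
  rw [reflLaplacian_eq_bondGrad_sub hN u hx]
  unfold bondGrad
  have ha : -(N : ℤ) ≤ x ∧ x < N → u x ≤ u (x + 1) := fun h => hmem _ (by omega) (by omega)
  have hb : -(N : ℤ) ≤ x - 1 ∧ x - 1 < N → u x ≤ u (x - 1) := fun h => hmem _ (by omega) (by omega)
  rw [sub_add_cancel]
  split_ifs with h3 h4 h4
  · linarith [ha h3, hb h4]
  · linarith [ha h3]
  · linarith [hb h4]
  · simp

theorem reflLaplacian_neg (N : ℕ) (u : ℤ → ℝ) (x : ℤ) :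
    reflLaplacian N (fun y => -u y) x = -reflLaplacian N u x := by
  unfold reflLaplacian
  split_ifs <;> ring

theorem reflLaplacian_nonpos_of_forall_ge {N : ℕ} (hN : 1 ≤ N) (u : ℤ → ℝ) {x : ℤ}
    (hx : x ∈ sites N) (hmax : ∀ y ∈ sites N, u y ≤ u x) : reflLaplacian N u x ≤ 0 := by
  have h := reflLaplacian_nonneg_of_forall_le hN (fun y => -u y) hx
    fun y hy => neg_le_neg (hmax y hy)
  rw [reflLaplacian_neg] at h
  linarith

theorem drift_eq (j : ℝ) (K N : ℕ) (u : ℤ → ℝ) (x : ℤ) :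
    drift j K N u x = (1 / 2) * ((eps N) ^ (-2 : ℤ) * reflLaplacian N u x) +
      (eps N)⁻¹ * (j / 2) * bdryTerm K N u x := rfl

theorem card_Ioc_le {N : ℕ} {x : ℤ} (hx : x ∈ sites N) :
    (Finset.Ioc x (N : ℤ)).card ≤ 2 * N := by
  have := Finset.mem_Icc.1 hx
  rw [Int.card_Ioc]; omega

theorem card_Ico_le {N : ℕ} {x : ℤ} (hx : x ∈ sites N) :
    (Finset.Ico (-(N : ℤ)) x).card ≤ 2 * N := by
  have := Finset.mem_Icc.1 hx
  rw [Int.card_Ico]; omega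

theorem boundary_products_mem {N : ℕ} {u : ℤ → ℝ} {η : ℝ} (hη0 : 0 ≤ η) (hη1 : η ≤ 1)
    (hu : ∀ y ∈ sites N, -η ≤ u y ∧ u y ≤ 1 + η) {x : ℤ} (hx : x ∈ sites N) :
    (-(η * 2 ^ (2 * N)) ≤ ∏ y ∈ Finset.Ioc x (N : ℤ), u y ∧
      ∏ y ∈ Finset.Ioc x (N : ℤ), u y ≤ 2 ^ (2 * N)) ∧
    (-(η * 2 ^ (2 * N)) ≤ ∏ y ∈ Finset.Ico (-(N : ℤ)) x, (1 - u y) ∧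
      ∏ y ∈ Finset.Ico (-(N : ℤ)) x, (1 - u y) ≤ 2 ^ (2 * N)) := by
  have hx' := Finset.mem_Icc.1 hx
  constructor
  · refine prod_mem_of_near_unit_of_card_le _ _ (card_Ioc_le hx) hη0 hη1 fun y hy => hu y ?_
    have := Finset.mem_Ioc.1 hy
    exact Finset.mem_Icc.2 (by omega)
  · refine prod_mem_of_near_unit_of_card_le _ _ (card_Ico_le hx) hη0 hη1 fun y hy => ?_
    have := Finset.mem_Ico.1 hy
    have := hu y (Finset.mem_Icc.2 (by omega))
    constructor <;> linarith

/-! ### Invariance of the unit interval -/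

/-- At a site with `u x = -η` the factor `1 - u x` of `D_+` is positive and the product is almost
nonnegative, while `D_-` carries the factor `u x = -η`. -/
theorem bdryTerm_ge_of_eq_neg {K N : ℕ} {u : ℤ → ℝ} {η : ℝ} (hη0 : 0 ≤ η) (hη1 : η ≤ 1)
    (hu : ∀ y ∈ sites N, -η ≤ u y ∧ u y ≤ 1 + η) {x : ℤ} (hx : x ∈ sites N) (hux : u x = -η) :
    -(3 * 2 ^ (2 * N) * η) ≤ bdryTerm K N u x := by
  obtain ⟨⟨h1, h2⟩, h3, h4⟩ := boundary_products_mem hη0 hη1 hu hx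
  have hD₁ : -(2 * 2 ^ (2 * N) * η) ≤ Dplus N u x := by
    unfold Dplus
    rw [hux]
    nlinarith [mul_le_mul_of_nonneg_left h1 (by linarith : 0 ≤ 1 - -η),
      mul_nonneg hη0 (by positivity : (0 : ℝ) ≤ 2 ^ (2 * N))]
  have hD₂ : Dminus N u x ≤ 2 ^ (2 * N) * η := by
    unfold Dminus
    rw [hux]
    nlinarith [mul_le_mul_of_nonneg_left h3 hη0,
      mul_nonneg hη0 (by positivity : (0 : ℝ) ≤ 2 ^ (2 * N))]
  have hnn : 0 ≤ 2 ^ (2 * N) * η := by positivity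
  unfold bdryTerm
  split_ifs <;> linarith

theorem bdryTerm_le_of_eq_one_add {K N : ℕ} {u : ℤ → ℝ} {η : ℝ} (hη0 : 0 ≤ η) (hη1 : η ≤ 1)
    (hu : ∀ y ∈ sites N, -η ≤ u y ∧ u y ≤ 1 + η) {x : ℤ} (hx : x ∈ sites N)
    (hux : u x = 1 + η) :
    bdryTerm K N u x ≤ 3 * 2 ^ (2 * N) * η := by
  obtain ⟨⟨h1, h2⟩, h3, h4⟩ := boundary_products_mem hη0 hη1 hu hx
  have hD₁ : Dplus N u x ≤ 2 ^ (2 * N) * η := by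
    unfold Dplus
    rw [hux]
    nlinarith [mul_le_mul_of_nonneg_left h1 hη0,
      mul_nonneg hη0 (by positivity : (0 : ℝ) ≤ 2 ^ (2 * N))]
  have hD₂ : -(2 * 2 ^ (2 * N) * η) ≤ Dminus N u x := by
    unfold Dminus
    rw [hux]
    nlinarith [mul_le_mul_of_nonneg_left h3 (by linarith : 0 ≤ 1 + η),
      mul_nonneg hη0 (by positivity : (0 : ℝ) ≤ 2 ^ (2 * N))]
  have hnn : 0 ≤ 2 ^ (2 * N) * η := by positivity
  unfold bdryTerm
  split_ifs <;> linarith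

theorem IsSolution.mem_Icc {j : ℝ} (hj : 0 ≤ j) {K N : ℕ} (hN : 1 ≤ N) {u₀ : ℝ → ℝ} {T : ℝ}
    {ρ : ℝ → ℤ → ℝ} (hρ : IsSolution j K N u₀ T ρ) (h01 : ∀ x ∈ sites N, ρ 0 x ∈ Set.Icc (0 : ℝ) 1)
    {t : ℝ} (ht : t ∈ Set.Icc (0 : ℝ) T) {x : ℤ} (hx : x ∈ sites N) :
    ρ t x ∈ Set.Icc (0 : ℝ) 1 := by
  have hε := eps_pos hN
  set a : ℝ := (eps N)⁻¹ * (j / 2) with ha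
  have ha0 : 0 ≤ a := by positivity
  set L : ℝ := a * (3 * 2 ^ (2 * N)) + 1 with hL
  have hL0 : 0 ≤ L := by positivity
  have key : ∀ κ : ℝ, 0 < κ → κ ≤ 1 → -κ < ρ t x ∧ ρ t x < 1 + κ := by
    intro κ hκ0 hκ1
    let e : ℝ → ℝ := fun s => κ * Real.exp (L * (s - T))
    have he0 : ∀ s, 0 < e s := fun s => by positivity
    have heκ : ∀ s ∈ Set.Icc (0 : ℝ) T, e s ≤ κ := fun s hs =>
      mul_le_of_le_one_right hκ0.le
        (Real.exp_le_one_iff.2 (mul_nonpos_of_nonneg_of_nonpos hL0 (by linarith [hs.2])))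
    have hed : ∀ s, HasDerivAt e (L * e s) s := by
      intro s
      have h := ((((hasDerivAt_id s).sub_const T).const_mul L).exp).const_mul κ
      exact h.congr_deriv (by simp only [e, id]; ring)
    let σ : Bool → ℝ := fun b => if b then 1 else -1
    let c : Bool → ℝ := fun b => if b then 1 else 0
    -- `b = false` tests `-ρ < e` and `b = true` tests `ρ - 1 < e`.
    have main := neg_of_forall_deriv_neg_at_zero (sites N ×ˢ (Finset.univ : Finset Bool)) (T := T)
      (fun i s => σ i.2 * ρ s i.1 - c i.2 - e s)
      (fun i s => σ i.2 * drift j K N (ρ s) i.1 - L * e s)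
      (by
        intro i hi s hs
        have h := hρ.2 i.1 (Finset.mem_product.1 hi).1 s hs
        exact ((h.const_mul (σ i.2)).sub_const (c i.2)).sub (hed s).hasDerivWithinAt)
      (by
        rintro ⟨y, b⟩ hi
        have h := h01 y (Finset.mem_product.1 hi).1
        have := he0 0
        cases b <;> simp only [σ, c] <;> simp <;> linarith [h.1, h.2])
      (by
        intro s hs hle
        have hu : ∀ y ∈ sites N, -e s ≤ ρ s y ∧ ρ s y ≤ 1 + e s := by
          intro y hy
          have h1 := hle (y, false) (by simp [hy])
          have h2 := hle (y, true) (by simp [hy])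
          simp [σ, c] at h1 h2
          constructor <;> linarith
        have hes1 : e s ≤ 1 := (heκ s hs).trans hκ1
        have hinv : 0 < (eps N) ^ (-2 : ℤ) := by positivity
        rintro ⟨y, b⟩ hi hzero
        have hy := (Finset.mem_product.1 hi).1
        dsimp only at hy
        have hes := he0 s
        cases b
        · have hval : ρ s y = -e s := by simp [σ, c] at hzero; linarith
          have hlap := reflLaplacian_nonneg_of_forall_le hN (ρ s) hy
            fun z hz => hval ▸ (hu z hz).1
          have hb := mul_le_mul_of_nonneg_left
            (bdryTerm_ge_of_eq_neg (K := K) hes.le hes1 hu hy hval) ha0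
          have := mul_nonneg hinv.le hlap
          simp only [σ, drift_eq, ← ha, hL, if_false, Bool.false_eq_true]
          nlinarith
        · have hval : ρ s y = 1 + e s := by simp [σ, c] at hzero; linarith
          have hlap := reflLaplacian_nonpos_of_forall_ge hN (ρ s) hy
            fun z hz => hval ▸ (hu z hz).2
          have hb := mul_le_mul_of_nonneg_left
            (bdryTerm_le_of_eq_one_add (K := K) hes.le hes1 hu hy hval) ha0
          have := mul_nonpos_of_nonneg_of_nonpos hinv.le hlap
          simp only [σ, drift_eq, ← ha, hL, if_true]
          nlinarith)
      t ht
    have h1 := main (x, false) (by simp [hx])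
    have h2 := main (x, true) (by simp [hx])
    have := heκ t ht
    simp [σ, c] at h1 h2
    constructor <;> linarith
  constructor
  · refine le_of_forall_pos_le_add fun κ hκ => ?_
    have := (key (min κ 1) (by positivity) (min_le_right _ _)).1
    linarith [min_le_left κ 1]
  · refine le_of_forall_pos_le_add fun κ hκ => ?_
    have := (key (min κ 1) (by positivity) (min_le_right _ _)).2
    linarith [min_le_left κ 1]

/-! ### A stationary barrier for the gradient -/

theorem abs_bdryTerm_le_one {K N : ℕ} {u : ℤ → ℝ} (hu : ∀ y ∈ sites N, u y ∈ Set.Icc (0 : ℝ) 1)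
    {x : ℤ} (hx : x ∈ sites N) : |bdryTerm K N u x| ≤ 1 := by
  have hx' := Finset.mem_Icc.1 hx
  have hux := hu x hx
  have hp₁ : ∀ y ∈ Finset.Ioc x (N : ℤ), u y ∈ Set.Icc (0 : ℝ) 1 := fun y hy => hu y (by
    have := Finset.mem_Ioc.1 hy
    exact Finset.mem_Icc.2 (by omega))
  have hp₂ : ∀ y ∈ Finset.Ico (-(N : ℤ)) x, u y ∈ Set.Icc (0 : ℝ) 1 := fun y hy => hu y (by
    have := Finset.mem_Ico.1 hy
    exact Finset.mem_Icc.2 (by omega))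
  have h1 : 0 ≤ ∏ y ∈ Finset.Ioc x (N : ℤ), u y := Finset.prod_nonneg fun y hy => (hp₁ y hy).1
  have h2 : ∏ y ∈ Finset.Ioc x (N : ℤ), u y ≤ 1 :=
    Finset.prod_le_one (fun y hy => (hp₁ y hy).1) fun y hy => (hp₁ y hy).2
  have h3 : 0 ≤ ∏ y ∈ Finset.Ico (-(N : ℤ)) x, (1 - u y) :=
    Finset.prod_nonneg fun y hy => by linarith [(hp₂ y hy).2]
  have h4 : ∏ y ∈ Finset.Ico (-(N : ℤ)) x, (1 - u y) ≤ 1 :=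
    Finset.prod_le_one (fun y hy => by linarith [(hp₂ y hy).2]) fun y hy => by
      linarith [(hp₂ y hy).1]
  have hD₁ : 0 ≤ Dplus N u x := mul_nonneg (by linarith [hux.2]) h1
  have hD₁' : Dplus N u x ≤ 1 := mul_le_one₀ (by linarith [hux.1]) h1 h2
  have hD₂ : 0 ≤ Dminus N u x := mul_nonneg hux.1 h3
  have hD₂' : Dminus N u x ≤ 1 := mul_le_one₀ hux.2 h3 h4
  unfold bdryTerm
  rw [abs_le]
  split_ifs <;> constructor <;> linarith

/-- A concave nonnegative profile in the distance `d` to an end point: it increases quadratically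
up to height `K ^ 2` at `d = K` and is constant from there on. -/
noncomputable def layer (K : ℕ) (d : ℝ) : ℝ := (K : ℝ) ^ 2 - (max ((K : ℝ) - d) 0) ^ 2

theorem layer_nonneg (K : ℕ) {d : ℝ} (hd : 0 ≤ d) : 0 ≤ layer K d := by
  have hK : (0 : ℝ) ≤ K := K.cast_nonneg
  have h : max ((K : ℝ) - d) 0 ≤ K := max_le (by linarith) hK
  unfold layer
  nlinarith [le_max_right ((K : ℝ) - d) 0]

theorem layer_le (K : ℕ) (d : ℝ) : layer K d ≤ (K : ℝ) ^ 2 := by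
  unfold layer
  linarith [sq_nonneg (max ((K : ℝ) - d) 0)]

/-- Concavity of `layer`, in the form of a nonpositive second difference. -/
theorem layer_second_diff_nonpos (K : ℕ) (d : ℝ) :
    layer K (d + 1) + layer K (d - 1) - 2 * layer K d ≤ 0 := by
  unfold layer
  rcases max_cases ((K : ℝ) - d) 0 with h | h <;>
  rcases max_cases ((K : ℝ) - (d + 1)) 0 with h' | h' <;>
  rcases max_cases ((K : ℝ) - (d - 1)) 0 with h'' | h'' <;>
  rw [h.1, h'.1, h''.1] <;> nlinarith

theorem layer_second_diff_le_neg_one (K : ℕ) {d : ℝ} (hd : d ≤ K) :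
    layer K (d + 1) + layer K (d - 1) - 2 * layer K d ≤ -1 := by
  unfold layer
  rw [max_eq_left (by linarith : (0 : ℝ) ≤ K - d),
    max_eq_left (by linarith : (0 : ℝ) ≤ K - (d - 1))]
  rcases max_cases ((K : ℝ) - (d + 1)) 0 with h' | h' <;> rw [h'.1] <;> nlinarith

/-- The sum of the two boundary layers; `x` labels the bond `{x, x + 1}`, at distance `x + N + 1`
and `N - x` from the Dirichlet points `-N - 1` and `N` of the gradient. -/
noncomputable def barrier (K N : ℕ) (x : ℤ) : ℝ :=
  layer K ((x : ℝ) + N + 1) + layer K ((N : ℝ) - x)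

theorem barrier_nonneg (K : ℕ) {N : ℕ} {x : ℤ} (h1 : -(N : ℤ) - 1 ≤ x) (h2 : x ≤ N) :
    0 ≤ barrier K N x := by
  have h1' : -(N : ℝ) - 1 ≤ x := by exact_mod_cast h1
  have h2' : (x : ℝ) ≤ N := by exact_mod_cast h2
  exact add_nonneg (layer_nonneg K (by linarith)) (layer_nonneg K (by linarith))

theorem barrier_le (K N : ℕ) (x : ℤ) : barrier K N x ≤ 2 * (K : ℝ) ^ 2 := by
  unfold barrier
  linarith [layer_le K ((x : ℝ) + N + 1), layer_le K ((N : ℝ) - x)]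

theorem barrier_second_diff (K N : ℕ) (x : ℤ) :
    barrier K N (x + 1) + barrier K N (x - 1) - 2 * barrier K N x =
      (layer K ((x : ℝ) + N + 1 + 1) + layer K ((x : ℝ) + N + 1 - 1)
        - 2 * layer K ((x : ℝ) + N + 1)) +
      (layer K ((N : ℝ) - x + 1) + layer K ((N : ℝ) - x - 1) - 2 * layer K ((N : ℝ) - x)) := by
  unfold barrier
  push_cast
  rw [show (x : ℝ) + 1 + N + 1 = x + N + 1 + 1 by ring,
    show (x : ℝ) - 1 + N + 1 = x + N + 1 - 1 by ring,
    show (N : ℝ) - (x + 1) = N - x - 1 by ring, show (N : ℝ) - (x - 1) = N - x + 1 by ring]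
  ring

/-- The second difference of the barrier controls the source term in the equation for the gradient:
the source vanishes on bonds at distance more than `K` from both Dirichlet points. -/
theorem abs_bdryTerm_sub_le {K N : ℕ} {u : ℤ → ℝ} (hu : ∀ y ∈ sites N, u y ∈ Set.Icc (0 : ℝ) 1)
    {x : ℤ} (h1 : -(N : ℤ) ≤ x) (h2 : x < N) :
    |bdryTerm K N u (x + 1) - bdryTerm K N u x| ≤
      -2 * (barrier K N (x + 1) + barrier K N (x - 1) - 2 * barrier K N x) := by
  rw [barrier_second_diff]
  have hl := layer_second_diff_nonpos K ((x : ℝ) + N + 1)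
  have hr := layer_second_diff_nonpos K ((N : ℝ) - x)
  have habs : |bdryTerm K N u (x + 1) - bdryTerm K N u x| ≤ 2 := by
    have h3 := abs_bdryTerm_le_one (K := K) hu (x := x) (Finset.mem_Icc.2 (by omega))
    have h4 := abs_bdryTerm_le_one (K := K) hu (x := x + 1) (Finset.mem_Icc.2 (by omega))
    have := abs_sub (bdryTerm K N u (x + 1)) (bdryTerm K N u x)
    linarith
  by_cases hL : x + N + 1 ≤ K
  · have := layer_second_diff_le_neg_one K (d := (x : ℝ) + N + 1) (by exact_mod_cast hL)
    linarith
  by_cases hR : (N : ℤ) - x ≤ K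
  · have := layer_second_diff_le_neg_one K (d := (N : ℝ) - x) (by exact_mod_cast hR)
    linarith
  · have hz : ∀ y : ℤ, y = x ∨ y = x + 1 → bdryTerm K N u y = 0 := by
      intro y hy
      unfold bdryTerm
      rw [if_neg, if_neg, sub_zero]
      · rw [leftBdry, Finset.mem_Icc]; omega
      · rw [rightBdry, Finset.mem_Icc]; omega
    rw [hz _ (Or.inl rfl), hz _ (Or.inr rfl), sub_zero, abs_zero]
    linarith

/-- The gradient satisfies a discrete heat equation with Dirichlet boundary values. -/
theorem drift_sub_eq (j : ℝ) (K : ℕ) {N : ℕ} (hN : 1 ≤ N) (u : ℤ → ℝ) {x : ℤ}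
    (h1 : -(N : ℤ) ≤ x) (h2 : x < N) :
    drift j K N u (x + 1) - drift j K N u x =
      (1 / 2) * ((eps N) ^ (-2 : ℤ) *
        (bondGrad N u (x + 1) + bondGrad N u (x - 1) - 2 * bondGrad N u x)) +
      (eps N)⁻¹ * (j / 2) * (bdryTerm K N u (x + 1) - bdryTerm K N u x) := by
  rw [drift_eq, drift_eq,
    reflLaplacian_eq_bondGrad_sub hN u (x := x + 1) (Finset.mem_Icc.2 (by omega)),
    reflLaplacian_eq_bondGrad_sub hN u (x := x) (Finset.mem_Icc.2 (by omega)),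
    add_sub_cancel_right]
  ring

/-- The gradient stays below `2 j ε * barrier + c₀ ε`: the factor `2 j ε` is chosen so that
`½ ε⁻²` times the second difference of this profile cancels the source. -/
theorem IsSolution.abs_sub_le {j : ℝ} (hj : 0 ≤ j) {K N : ℕ} (hN : 1 ≤ N) {u₀ : ℝ → ℝ} {T : ℝ}
    {ρ : ℝ → ℤ → ℝ} (hρ : IsSolution j K N u₀ T ρ) (h01 : ∀ x ∈ sites N, ρ 0 x ∈ Set.Icc (0 : ℝ) 1)
    {c₀ : ℝ} (hc₀ : 0 ≤ c₀)
    (hinit : ∀ x : ℤ, -(N : ℤ) ≤ x → x < N → |ρ 0 (x + 1) - ρ 0 x| ≤ c₀ * eps N)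
    {t : ℝ} (ht : t ∈ Set.Icc (0 : ℝ) T) {x : ℤ} (hx₁ : -(N : ℤ) ≤ x) (hx₂ : x < N) :
    |ρ t x - ρ t (x + 1)| ≤ (4 * j * (K : ℝ) ^ 2 + c₀) * eps N := by
  have hε := eps_pos hN
  set ε := eps N with hε_def
  let W : ℤ → ℝ := fun y => 2 * j * ε * barrier K N y + c₀ * ε
  have hW0 : ∀ y : ℤ, -(N : ℤ) - 1 ≤ y → y ≤ N → 0 ≤ W y := fun y h1 h2 => by
    have := barrier_nonneg K h1 h2
    positivity
  have key : ∀ δ : ℝ, 0 < δ → |ρ t x - ρ t (x + 1)| < W x + δ * (1 + t) := by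
    intro δ hδ
    let σ : Bool → ℝ := fun b => if b then 1 else -1
    have hσ : ∀ b r, σ b * r ≤ |r| := by
      intro b r
      cases b <;> simp [σ, le_abs_self, neg_le_abs]
    -- The small drift `δ (1 + t)` makes the comparison strict.
    have main := neg_of_forall_deriv_neg_at_zero
      (Finset.Ico (-(N : ℤ)) N ×ˢ (Finset.univ : Finset Bool)) (T := T)
      (fun i s => σ i.2 * (ρ s (i.1 + 1) - ρ s i.1) - (W i.1 + δ * (1 + s)))
      (fun i s => σ i.2 * (drift j K N (ρ s) (i.1 + 1) - drift j K N (ρ s) i.1) - δ)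
      (by
        rintro ⟨y, b⟩ hi s hs
        have hy := Finset.mem_Ico.1 (Finset.mem_product.1 hi).1
        dsimp only at hy ⊢
        have h1 := hρ.2 (y + 1) (Finset.mem_Icc.2 (by omega)) s hs
        have h2 := hρ.2 y (Finset.mem_Icc.2 (by omega)) s hs
        have h3 : HasDerivAt (fun r => W y + δ * (1 + r)) δ s := by
          simpa using (((hasDerivAt_id s).const_add 1).const_mul δ).const_add (W y)
        exact ((h1.sub h2).const_mul (σ b)).sub h3.hasDerivWithinAt)
      (by
        rintro ⟨y, b⟩ hi
        have hy := Finset.mem_Ico.1 (Finset.mem_product.1 hi).1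
        dsimp only at hy ⊢
        have h1 := (hσ b _).trans (hinit y hy.1 hy.2)
        have h2 := barrier_nonneg K (N := N) (x := y) (by omega) (by omega)
        have h3 : 0 ≤ 2 * j * ε * barrier K N y := by positivity
        simp only [W]
        linarith)
      (by
        intro s hs hle
        have hs0 := hs.1
        have hu : ∀ y ∈ sites N, ρ s y ∈ Set.Icc (0 : ℝ) 1 := fun y hy => hρ.mem_Icc hj hN h01 hs hy
        -- At the Dirichlet points the gradient vanishes, so the barrier dominates it there too.
        have hg : ∀ (b : Bool) (y : ℤ), -(N : ℤ) - 1 ≤ y → y ≤ N →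
            σ b * bondGrad N (ρ s) y ≤ W y + δ * (1 + s) := by
          intro b y h1 h2
          unfold bondGrad
          split_ifs with h
          · have := hle (y, b) (by simp [h.1, h.2])
            dsimp only at this
            linarith
          · have := hW0 y h1 h2
            rw [mul_zero]
            positivity
        rintro ⟨y, b⟩ hi hzero
        have hy := Finset.mem_Ico.1 (Finset.mem_product.1 hi).1
        dsimp only at hy hzero ⊢
        have hgy : σ b * bondGrad N (ρ s) y = W y + δ * (1 + s) := by
          rw [bondGrad, if_pos hy]; linarith
        have hp := hg b (y + 1) (by omega) (by omega)
        have hm := hg b (y - 1) (by omega) (by omega)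
        have hB := (hσ b _).trans (abs_bdryTerm_sub_le (K := K) hu hy.1 hy.2)
        rw [drift_sub_eq j K hN _ hy.1 hy.2, ← hε_def]
        have hlap : σ b * (bondGrad N (ρ s) (y + 1) + bondGrad N (ρ s) (y - 1)
            - 2 * bondGrad N (ρ s) y) ≤ 2 * j * ε *
              (barrier K N (y + 1) + barrier K N (y - 1) - 2 * barrier K N y) := by
          simp only [W] at hgy hp hm
          linarith
        generalize bondGrad N (ρ s) (y + 1) + bondGrad N (ρ s) (y - 1)
            - 2 * bondGrad N (ρ s) y = G at *
        generalize barrier K N (y + 1) + barrier K N (y - 1) - 2 * barrier K N y = D at *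
        generalize bdryTerm K N (ρ s) (y + 1) - bdryTerm K N (ρ s) y = S at *
        have hz : ε ^ (-2 : ℤ) = ε⁻¹ * ε⁻¹ := by
          rw [show (-2 : ℤ) = -1 + -1 by norm_num, zpow_add₀ hε.ne', zpow_neg_one]
        have hi0 : 0 < ε⁻¹ := inv_pos.2 hε
        have e1 := mul_le_mul_of_nonneg_left hlap (by positivity : 0 ≤ 1 / 2 * (ε⁻¹ * ε⁻¹))
        have e2 := mul_le_mul_of_nonneg_left hB (by positivity : 0 ≤ ε⁻¹ * (j / 2))
        have e3 : 1 / 2 * (ε⁻¹ * ε⁻¹) * (2 * j * ε * D) = ε⁻¹ * j * D := by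
          field_simp
        rw [e3] at e1
        rw [hz]
        nlinarith)
      t ht
    have h1 := main (x, false) (by simp [hx₁, hx₂])
    have h2 := main (x, true) (by simp [hx₁, hx₂])
    simp [σ] at h1 h2
    rw [abs_lt]
    constructor <;> linarith
  have hlim : |ρ t x - ρ t (x + 1)| ≤ W x := by
    refine le_of_forall_pos_le_add fun κ hκ => ?_
    have ht1 : 0 < 1 + t := by linarith [ht.1]
    have := key (κ / (1 + t)) (by positivity)
    rw [div_mul_cancel₀ _ ht1.ne'] at this
    exact this.le
  have := mul_le_mul_of_nonneg_left (barrier_le K N x) (by positivity : 0 ≤ 2 * j * ε)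
  simp only [W] at hlim
  linarith

/-! ### The boundary integral -/

theorem heatKernel_nonneg (t x y : ℝ) : 0 ≤ heatKernel t x y :=
  div_nonneg (Real.exp_nonneg _) (Real.sqrt_nonneg _)

theorem bdryIntegrand_nonneg (K N : ℕ) (x : ℤ) (s : ℝ) : 0 ≤ bdryIntegrand K N x s :=
  mul_nonneg (by positivity) (Finset.sum_nonneg fun _ _ => heatKernel_nonneg _ _ _)

theorem measurable_bdryIntegrand (K N : ℕ) (x : ℤ) : Measurable (bdryIntegrand K N x) := by
  unfold bdryIntegrand heatKernel
  fun_prop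

theorem heatKernel_le {t : ℝ} (ht : 0 < t) (x y : ℝ) : heatKernel t x y ≤ 1 / Real.sqrt t := by
  have h1 : Real.exp (-(x - y) ^ 2 / (2 * t)) ≤ 1 :=
    Real.exp_le_one_iff.2 (div_nonpos_of_nonpos_of_nonneg (by nlinarith [sq_nonneg (x - y)])
      (by positivity))
  have h2 : Real.sqrt t ≤ Real.sqrt (2 * Real.pi * t) :=
    Real.sqrt_le_sqrt (by nlinarith [Real.pi_gt_three])
  exact div_le_div₀ zero_le_one h1 (Real.sqrt_pos.2 ht) h2

/-- The integrand is dominated by a multiple of `s ^ (-1/2)`, including the sites `x ∈ I_- ∪ I_+`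
where the summand `z = x` is singular at `s = 0`. -/
theorem intervalIntegrable_bdryIntegrand (K : ℕ) {N : ℕ} (hN : 1 ≤ N) (x : ℤ) {t : ℝ}
    (ht : 0 ≤ t) : IntervalIntegrable (bdryIntegrand K N x) MeasureTheory.volume 0 t := by
  have hε := eps_pos hN
  set S := leftBdry N K ∪ rightBdry N K with hS
  have hdom : IntervalIntegrable (fun s : ℝ => (S.card : ℝ) * eps N * s ^ (-(1 / 2) : ℝ))
      MeasureTheory.volume 0 t :=
    (intervalIntegral.intervalIntegrable_rpow' (by norm_num)).const_mul _
  refine hdom.mono_fun (measurable_bdryIntegrand K N x).aestronglyMeasurable ?_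
  rw [Set.uIoc_of_le ht]
  refine (MeasureTheory.ae_restrict_iff' measurableSet_Ioc).2 (Filter.Eventually.of_forall ?_)
  intro s hs
  have hs0 : 0 < s := hs.1
  have hpos : 0 < eps N ^ (-2 : ℤ) * s := by positivity
  have hsqrt : 1 / Real.sqrt (eps N ^ (-2 : ℤ) * s) = eps N * s ^ (-(1 / 2) : ℝ) := by
    rw [Real.sqrt_mul (by positivity), Real.rpow_neg hs0.le, ← Real.sqrt_eq_rpow,
      show eps N ^ (-2 : ℤ) = ((eps N)⁻¹) ^ 2 by
        rw [zpow_neg, inv_pow]; norm_cast, Real.sqrt_sq (by positivity)]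
    field_simp
  dsimp only
  rw [Real.norm_of_nonneg (bdryIntegrand_nonneg K N x s),
    Real.norm_of_nonneg (by positivity)]
  have h1 : 1 / (Real.sqrt (eps N ^ (-2 : ℤ) * s) + 1) ≤ 1 :=
    (div_le_one (by positivity)).2 (by linarith [Real.sqrt_nonneg (eps N ^ (-2 : ℤ) * s)])
  have h2 : ∑ z ∈ S, heatKernel (eps N ^ (-2 : ℤ) * s) (x : ℝ) (z : ℝ) ≤
      S.card * (eps N * s ^ (-(1 / 2) : ℝ)) := by
    rw [← nsmul_eq_mul]
    exact Finset.sum_le_card_nsmul _ _ _ fun z _ => hsqrt ▸ heatKernel_le hpos _ _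
  have h3 : 0 ≤ ∑ z ∈ S, heatKernel (eps N ^ (-2 : ℤ) * s) (x : ℝ) (z : ℝ) :=
    Finset.sum_nonneg fun _ _ => heatKernel_nonneg _ _ _
  calc bdryIntegrand K N x s
      ≤ ∑ z ∈ S, heatKernel (eps N ^ (-2 : ℤ) * s) (x : ℝ) (z : ℝ) := mul_le_of_le_one_left h3 h1
    _ ≤ _ := by rw [mul_assoc]; exact h2

/-! ### The uniform gradient bound -/

theorem eps_mul_mem_Icc {N : ℕ} (hN : 1 ≤ N) {x : ℤ} (hx : x ∈ sites N) :
    eps N * (x : ℝ) ∈ Set.Icc (-1 : ℝ) 1 := by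
  obtain ⟨h1, h2⟩ := Finset.mem_Icc.1 hx
  have hN' : (0 : ℝ) < N := by exact_mod_cast hN
  have h1' : -(N : ℝ) ≤ x := by exact_mod_cast h1
  have h2' : (x : ℝ) ≤ N := by exact_mod_cast h2
  rw [eps, one_div_mul_eq_div]
  exact ⟨(le_div_iff₀ hN').2 (by linarith), (div_le_iff₀ hN').2 (by linarith)⟩

/-- The differences are `O(ε)` uniformly in time and space; the constant depends only on `j`, `K` and
a Lipschitz constant of `u₀`. -/
theorem exists_abs_sub_le_mul_eps {j : ℝ} (hj : 0 ≤ j) {K : ℕ} (hK : 1 ≤ K) (T : ℝ) {u₀ : ℝ → ℝ}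
    (hu₀ : ContDiffOn ℝ ∞ u₀ (Set.Icc (-1) 1))
    (hu₀01 : Set.MapsTo u₀ (Set.Icc (-1) 1) (Set.Icc 0 1)) :
    ∃ c : ℝ, 0 ≤ c ∧ ∀ N : ℕ, K ≤ N → ∀ ρ : ℝ → ℤ → ℝ, IsSolution j K N u₀ T ρ →
      ∀ x : ℤ, -(N : ℤ) ≤ x → x < N → ∀ t ∈ Set.Icc (0 : ℝ) T,
        |ρ t x - ρ t (x + 1)| ≤ c * eps N := by
  obtain ⟨L, hL⟩ := hu₀.exists_lipschitzOnWith (by simp) (convex_Icc _ _) isCompact_Icc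
  refine ⟨4 * j * (K : ℝ) ^ 2 + L, by positivity, fun N hKN ρ hρ x hx₁ hx₂ t ht => ?_⟩
  have hN := hK.trans hKN
  refine hρ.abs_sub_le hj hN (fun y hy => ?_) L.2 (fun y hy₁ hy₂ => ?_) ht hx₁ hx₂
  · rw [hρ.1 y hy]
    exact hu₀01 (eps_mul_mem_Icc hN hy)
  · have h1 : y ∈ sites N := Finset.mem_Icc.2 (by omega)
    have h2 : y + 1 ∈ sites N := Finset.mem_Icc.2 (by omega)
    have h := hL.dist_le_mul _ (eps_mul_mem_Icc hN h2) _ (eps_mul_mem_Icc hN h1)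
    rw [hρ.1 y h1, hρ.1 _ h2]
    rw [Real.dist_eq, Real.dist_eq, ← mul_sub] at h
    push_cast at h ⊢
    rwa [add_sub_cancel_left, mul_one, abs_of_pos (eps_pos hN)] at h

end StirringBD

theorem lemma2p3 (j : ℝ) (hj : 0 < j) (K : ℕ) (hK : 1 ≤ K) (T : ℝ) (hT : 0 < T)
    (u₀ : ℝ → ℝ) (hu₀ : ContDiffOn ℝ ∞ u₀ (Set.Icc (-1) 1))
    (hu₀01 : Set.MapsTo u₀ (Set.Icc (-1) 1) (Set.Icc 0 1)) :
    (∃ c : ℝ, ∀ N : ℕ, K ≤ N → StirringBD.eps N < 1 →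
      ∀ ρ : ℝ → ℤ → ℝ, StirringBD.IsSolution j K N u₀ T ρ →
      ∀ x ∈ Finset.Icc (-(N : ℤ)) ((N : ℤ) - 1), ∀ t ∈ Set.Icc (0 : ℝ) T,
        IntervalIntegrable (StirringBD.bdryIntegrand K N x) MeasureTheory.volume 0 t ∧
        |ρ t x - ρ t (x + 1)| ≤ c * StirringBD.eps N +
          (StirringBD.eps N)⁻¹ * (j / 2) * ∫ s in (0 : ℝ)..t, StirringBD.bdryIntegrand K N x s) ∧
    (∀ ζ : ℝ, 0 < ζ → ∃ C : ℝ, ∀ N : ℕ, K ≤ N → StirringBD.eps N < 1 →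
      ∀ ρ : ℝ → ℤ → ℝ, StirringBD.IsSolution j K N u₀ T ρ →
      ∀ t ∈ Set.Icc (0 : ℝ) T, ∀ x ∈ StirringBD.sites N, ∀ y ∈ StirringBD.sites N,
        |x - y| ≤ 1 →
        |ρ t x - ρ t y| ≤ C * (StirringBD.eps N) ^ (1 - 2 * ζ)) := by
  obtain ⟨c, hc0, hc⟩ := StirringBD.exists_abs_sub_le_mul_eps hj.le hK T hu₀ hu₀01
  refine ⟨⟨c, fun N hKN _ ρ hρ x hx t ht => ?_⟩, fun ζ hζ => ⟨c, ?_⟩⟩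
  · have hN := hK.trans hKN
    have hε := StirringBD.eps_pos hN
    obtain ⟨h1, h2⟩ := Finset.mem_Icc.1 hx
    refine ⟨StirringBD.intervalIntegrable_bdryIntegrand K hN x ht.1, ?_⟩
    have hint : 0 ≤ ∫ s in (0 : ℝ)..t, StirringBD.bdryIntegrand K N x s :=
      intervalIntegral.integral_nonneg ht.1 fun s _ => StirringBD.bdryIntegrand_nonneg K N x s
    exact (hc N hKN ρ hρ x h1 (by omega) t ht).trans (le_add_of_nonneg_right (by positivity))
  · intro N hKN hε1 ρ hρ t ht x hx y hy hxy
    have hε := StirringBD.eps_pos (hK.trans hKN)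
    obtain ⟨hx₁, hx₂⟩ := Finset.mem_Icc.1 hx
    obtain ⟨hy₁, hy₂⟩ := Finset.mem_Icc.1 hy
    have hpow : c * StirringBD.eps N ≤ c * StirringBD.eps N ^ (1 - 2 * ζ) := by
      refine mul_le_mul_of_nonneg_left ?_ hc0
      simpa using Real.rpow_le_rpow_of_exponent_ge hε hε1.le (by linarith : 1 - 2 * ζ ≤ 1)
    refine le_trans ?_ hpow
    obtain ⟨h1, h2⟩ := abs_le.1 hxy
    obtain rfl | rfl | rfl : y = x + 1 ∨ y = x ∨ x = y + 1 := by omega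
    · exact hc N hKN ρ hρ x hx₁ (by omega) t ht
    · rw [sub_self, abs_zero]; positivity
    · rw [abs_sub_comm]
      exact hc N hKN ρ hρ y hy₁ (by omega) t ht
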